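/- Let $K$ be a number of groups, let $\theta,\beta>0$ and $\epsilon_1,\dots,\epsilon_K>0$, let $\Delta_K=\{x\in[0,1]^K:\sum_k x_k=1\}$ and $\Delta_K^\circ=\{x\in\Delta_K: x_k>0\ \text{for all }k\}$, and put $$p_k(x)=\frac{\theta x_k^{-\beta}+\epsilon_k}{\sum_{j=1}^K\left(\theta x_j^{-\beta}+\epsilon_j\right)},\qquad x\in\Delta_K^\circ .$$ Let $N(t)=N(0)+t$ with $N(0)\ge 1$ an integer (the total population, one individual arriving at each time step), and let $\gamma_t=\frac1{N(t)+1}$. On a probability space with a filtration $(\mathcal F_t)_{t\ge0}$ let $\pi(t)$ be an adapted process with $\pi(0)\in\Delta_K^\circ$ almost surely and $$\pi_k(t+1)=\pi_k(t)+\gamma_t\left(\tilde p_k(t)-\pi_k(t)\right),\qquad k=1,\dots,K,\ t\ge 0,$$ almost surely, where $\tilde p(t)$ is an $\mathcal F_{t+1}$-measurable random vector with $\tilde p(t)\in\Delta_K$ almost surely and $\mathbb E[\tilde p_k(t)\mid\mathcal F_t]=p_k(\pi(t))$. This includes the update $\pi_k(t+1)=\pi_k(t)+\gamma_t\left(p_k(\pi(t))-\pi_k(t)\right)$,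 which is the case $\tilde p(t)=p(\pi(t))$, and its sampled version, in which $\tilde p(t)$ is the indicator vector of the group that a random entrant joins. Then: (i) $\pi(t)$ is a Robbins–Monro stochastic approximation with drift $f(x)=p(x)-x$, that is: $\gamma_t>0$, $\gamma_t\to0$, $\sum_t\gamma_t=\infty$ and $\sum_t\gamma_t^2<\infty$; $f$ is Lipschitz on every compact subset of the bounded set $\Delta_K^\circ$; almost surely all the $\pi(t)$, $t\ge0$, lie in one compact subset of $\Delta_K^\circ$ (which may depend on the sample point); and, almost surely, $\pi(t+1)=\pi(t)+\gamma_t\left(f(\pi(t))+U(t)\right)$ for all $t$, where $U(t)$ is $\mathcal F_{t+1}$-measurable, bounded almost surely by a constant that does not depend on $t$, and satisfies $\mathbb E[U(t)\mid\mathcal F_t]=0$. (ii) There is a point $\pi^*\in\Delta_K$, with $\pi^*_k>0$ and $\pi^*_k=p_k(\pi^*)$ for all $k=1,\dots,K$, such that $\pi(t)$ converges to $\pi^*$ almost surely. -/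

import Mathlib

open MeasureTheory ProbabilityTheory Filter Topology
open scoped NNReal

/-- The probability `p_k(x) = (θ x_k ^ (-β) + ε_k) / ∑ j, (θ x_j ^ (-β) + ε_j)` that a new entrant
joins group `k` when the group proportions are `x`. -/
noncomputable def choiceProb {K : ℕ} (θ β : ℝ) (ε x : Fin K → ℝ) : Fin K → ℝ :=
  fun k => (θ * x k ^ (-β) + ε k) / ∑ j, (θ * x j ^ (-β) + ε j)

/-- The drift `f(x) = p(x) - x`. -/
noncomputable def drift {K : ℕ} (θ β : ℝ) (ε x : Fin K → ℝ) : Fin K → ℝ :=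
  choiceProb θ β ε x - x

/-- The total population at time `t`: it is `N₀` at time `0`, and one individual arrives at each
time step. -/
def population (N₀ t : ℕ) : ℕ := N₀ + t

/-- The step size `γ_t = 1 / (N(t) + 1)`. -/
noncomputable def stepSize (N₀ t : ℕ) : ℝ := 1 / ((population N₀ t : ℝ) + 1)

/-- The relative interior of the simplex `Δ_K`, on which all the powers `x_k ^ (-β)` make sense. -/
def openSimplex (K : ℕ) : Set (Fin K → ℝ) :=
  {x | x ∈ stdSimplex ℝ (Fin K) ∧ ∀ k, 0 < x k}

/-- The process `x`, adapted to the filtration `ℱ`, is a Robbins-Monro stochastic approximation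
`x(t+1) = x(t) + γ_t (f(x(t)) + U(t))` with steps `γ`, drift `f` and state space `D`, in the sense
of the usual conditions: on the step sizes; boundedness of the iterates; Lipschitz drift; and
bounded martingale difference noise (`U t` is the noise that enters between `t` and `t + 1`). -/
structure IsRobbinsMonro {K : ℕ} {Ω : Type*} {mΩ : MeasurableSpace Ω} (P : Measure Ω)
    (ℱ : Filtration ℕ mΩ) (γ : ℕ → ℝ) (f : (Fin K → ℝ) → (Fin K → ℝ)) (D : Set (Fin K → ℝ))
    (x : ℕ → Ω → Fin K → ℝ) : Prop where
  step_pos : ∀ t, 0 < γ t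
  step_tendsto_zero : Tendsto γ atTop (𝓝 0)
  step_sum : Tendsto (fun n => ∑ t ∈ Finset.range n, γ t) atTop atTop
  step_sq_summable : Summable fun t => γ t ^ 2
  adapted : ∀ t, Measurable[ℱ t] (x t)
  bounded : Bornology.IsBounded D
  /-- The drift is Lipschitz on compact subsets of the state space. -/
  lipschitz : ∀ C ⊆ D, IsCompact C → ∃ L : ℝ≥0, LipschitzOnWith L f C
  /-- Almost surely, all the iterates lie in one compact subset of the state space. -/
  iterates : ∀ᵐ ω ∂P, ∃ C ⊆ D, IsCompact C ∧ ∀ t, x t ω ∈ C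
  recursion : ∃ U : ℕ → Ω → Fin K → ℝ,
    (∀ t, Measurable[ℱ (t + 1)] (U t)) ∧
    (∃ B : ℝ, ∀ t, ∀ᵐ ω ∂P, ∀ k, |U t ω k| ≤ B) ∧
    (∀ t k, P[fun ω => U t ω k | ℱ t] =ᵐ[P] 0) ∧
    (∀ᵐ ω ∂P, ∀ t, x (t + 1) ω = x t ω + γ t • (f (x t ω) + U t ω))

/-!
The proof rests on a Lyapunov function that is bounded on the whole simplex, boundary included, so
that no separate argument is needed to keep the process away from the boundary, where `p` is
singular.

Let `q` be a fixed point of `p` with positive coordinates (`exists_choiceProb_eq_self`: such a point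
has `q_k / (θ q_k ^ (-β) + ε_k)` independent of `k`, and is found by the intermediate value
theorem). The Lyapunov function is `W(x) = ∑ k, q_k log (2 q_k / (x_k + q_k))`, the relative entropy
of `q` with respect to `(x + q) / 2`. It is nonnegative and vanishes only at `q`. Put
`Q(x) = ∑ k, (q_k - x_k) ^ 2 / (x_k + q_k)`. Then `W ≤ Q / 2`, and the derivative of `W` along the
drift is at most `-Q / 4` (`midpointEntropy_le_drift`). For the latter, this derivative equals
`-(1/2) ∑ k, (q_k - x_k) (p_k(x) - x_k) / (x_k + q_k)`, because `p(x) - x` has sum zero. Let `S(x)`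
be the normalizing sum of `p` and `s = S(q) / S(x)`. Since `θ y ^ (-β) + ε_k` is decreasing in `y`,
the difference `p_k(x) - s q_k` has the sign of `q_k - x_k` or vanishes, so `p_k(x)` may be replaced
by `s q_k`; the expression becomes `-(1 + s) Q / 4`, because `q - x` has sum zero.

The second-order error of `W` along a step is at most `γ_t ^ 2 ∑ k, 1 / q_k`, so
`E[W(π(t+1)) | ℱ_t] ≤ (1 - γ_t / 2) W(π(t)) + C γ_t ^ 2` (`condExp_midpointEntropy_succ_le`). By the
martingale convergence theorem `W(π(t))` converges and `∑ γ_t W(π(t))` is finite; as `∑ γ_t`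
diverges, the limit is zero (`ae_tendsto_zero_of_condExp_succ_le`). Hence `π(t)` tends to `q`.

The limit lies in the open simplex, and so does every `π(t)`, so each path together with its limit
is a compact subset of the open simplex. The noise is `U(t) = X(t) - p(π(t))`.
-/

/-! ### Existence of the fixed point -/

/-- For each `k`, the map `u ↦ u - log (θ e ^ (-β u) + ε_k)`, which is `log (x / (θ x ^ (-β) + ε_k))`
at `x = e ^ u`, is an increasing bijection of the line. -/
theorem exists_orderIso_logRatio {θ β ε : ℝ} (hθ : 0 < θ) (hβ : 0 < β) (hε : 0 < ε) :
    ∃ e : ℝ ≃o ℝ, ∀ u, e u = u - Real.log (θ * Real.exp (-β * u) + ε) := by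
  have hpos : ∀ u, 0 < θ * Real.exp (-β * u) + ε := fun u => by positivity
  have hanti : ∀ u v, u ≤ v → Real.log (θ * Real.exp (-β * v) + ε) ≤
      Real.log (θ * Real.exp (-β * u) + ε) := fun u v huv => by
    apply Real.log_le_log (hpos v)
    gcongr ?_ * Real.exp ?_ + _
    nlinarith
  have hmono : StrictMono fun u => u - Real.log (θ * Real.exp (-β * u) + ε) := fun u v huv => by
    have := hanti u v huv.le
    dsimp only
    linarith
  have hcont : Continuous fun u => u - Real.log (θ * Real.exp (-β * u) + ε) := by
    refine continuous_id.sub (Continuous.log (by fun_prop) fun u => (hpos u).ne')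
  have htop : Tendsto (fun u => u - Real.log (θ * Real.exp (-β * u) + ε)) atTop atTop := by
    refine tendsto_atTop_mono' _ ?_
      (tendsto_atTop_add_const_right _ (-Real.log (θ * Real.exp (-β * 0) + ε)) tendsto_id)
    filter_upwards [eventually_ge_atTop 0] with u hu
    have := hanti 0 u hu
    simp only [id]
    linarith
  have hbot : Tendsto (fun u => u - Real.log (θ * Real.exp (-β * u) + ε)) atBot atBot := by
    refine tendsto_atBot_mono (fun u => ?_)
      (tendsto_atBot_add_const_right _ (-Real.log ε) tendsto_id)
    have : Real.log ε ≤ Real.log (θ * Real.exp (-β * u) + ε) :=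
      Real.log_le_log hε (by have := Real.exp_pos (-β * u); nlinarith)
    simp only [id]
    linarith
  exact ⟨hmono.orderIsoOfSurjective _ (hcont.surjective htop hbot), fun u => rfl⟩

/-- The map `p` has a fixed point with positive coordinates. Such a point satisfies
`x_k / (θ x_k ^ (-β) + ε_k) = e ^ c` for all `k`, with the same `c`; this determines `x` as a
continuous increasing function of `c`, and `c` is found from `∑ k, x_k = 1`. -/
theorem exists_choiceProb_eq_self {K : ℕ} (hK : 0 < K) {θ β : ℝ} {ε : Fin K → ℝ}
    (hθ : 0 < θ) (hβ : 0 < β) (hε : ∀ k, 0 < ε k) :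
    ∃ q ∈ openSimplex K, ∀ k, q k = choiceProb θ β ε q k := by
  have : Nonempty (Fin K) := ⟨⟨0, hK⟩⟩
  choose e he using fun k => exists_orderIso_logRatio hθ hβ (hε k)
  have hKR : (0 : ℝ) < K := by exact_mod_cast hK
  have hcont : Continuous fun c => ∑ k, Real.exp ((e k).symm c) :=
    continuous_finsetSum _ fun k _ => Real.continuous_exp.comp (e k).symm.continuous
  obtain ⟨c, hc⟩ : (1 : ℝ) ∈ Set.range fun c => ∑ k, Real.exp ((e k).symm c) := by
    refine mem_range_of_exists_le_of_exists_ge hcont ?_ ?_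
    · obtain ⟨k₀, hk₀⟩ := Finite.exists_min fun k => e k (-Real.log K)
      refine ⟨e k₀ (-Real.log K), ?_⟩
      calc ∑ k, Real.exp ((e k).symm (e k₀ (-Real.log K)))
          ≤ ∑ _k : Fin K, (K : ℝ)⁻¹ := by
            refine Finset.sum_le_sum fun k _ => ?_
            rw [← Real.exp_log (inv_pos.2 hKR), Real.log_inv]
            exact Real.exp_le_exp.2 ((e k).symm_apply_le.2 (hk₀ k))
        _ = 1 := by simp [hKR.ne']
    · let k₀ : Fin K := ⟨0, hK⟩
      refine ⟨e k₀ 0, ?_⟩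
      calc (1 : ℝ) = Real.exp ((e k₀).symm (e k₀ 0)) := by simp
        _ ≤ _ := Finset.single_le_sum (f := fun k => Real.exp ((e k).symm (e k₀ 0)))
            (fun k _ => (Real.exp_pos _).le) (Finset.mem_univ k₀)
  set q : Fin K → ℝ := fun k => Real.exp ((e k).symm c) with hq
  have hqpos : ∀ k, 0 < q k := fun k => Real.exp_pos _
  have hg : ∀ k, θ * q k ^ (-β) + ε k = Real.exp (-c) * q k := fun k => by
    have hpos : 0 < θ * Real.exp (-β * (e k).symm c) + ε k := by
      have := hε k; positivity
    have h1 := he k ((e k).symm c)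
    rw [OrderIso.apply_symm_apply] at h1
    have h2 : q k ^ (-β) = Real.exp (-β * (e k).symm c) := by
      rw [hq]; dsimp only; rw [← Real.exp_mul, mul_comm]
    rw [h2, hq, ← Real.exp_add, ← Real.exp_log hpos]
    congr 1
    linarith
  refine ⟨q, ⟨⟨fun k => (hqpos k).le, hc⟩, hqpos⟩, fun k => ?_⟩
  have hsum : ∑ j, q j = 1 := hc
  have := Real.exp_pos (-c)
  simp only [choiceProb, hg, ← Finset.mul_sum, hsum]
  field_simp

/-! ### The Lyapunov function -/

/-- The relative entropy of the distribution `q` with respect to the midpoint `(x + q) / 2`, as a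
function of `x`. Unlike the relative entropy of `q` with respect to `x`, it is smooth up to the
boundary of the simplex. -/
noncomputable def midpointEntropy {K : ℕ} (q x : Fin K → ℝ) : ℝ :=
  ∑ k, q k * Real.log (2 * q k / (x k + q k))

section
variable {K : ℕ} {q x : Fin K → ℝ}

/-- Strict positivity of the entropy away from `q`, from `log u ≤ 2 (√u - 1)`. -/
theorem sum_mul_sq_one_sub_sqrt_le_midpointEntropy (hq : q ∈ openSimplex K)
    (hx : x ∈ stdSimplex ℝ (Fin K)) :
    ∑ k, q k * (1 - √((x k + q k) / (2 * q k))) ^ 2 ≤ midpointEntropy q x := by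
  have hs : ∑ k, (q k - x k) / 2 = 0 := by
    rw [← Finset.sum_div, Finset.sum_sub_distrib, hq.1.2, hx.2]; simp
  rw [← add_zero (∑ k, q k * _), ← hs, ← Finset.sum_add_distrib]
  refine Finset.sum_le_sum fun k _ => ?_
  have hqk := hq.2 k
  have hxk := hx.1 k
  set u := (x k + q k) / (2 * q k) with hu
  have hu0 : 0 < u := by positivity
  have h1 : Real.log (2 * q k / (x k + q k)) = -Real.log u := by
    rw [← Real.log_inv, hu, inv_div]
  have h2 : Real.log u = 2 * Real.log √u := by rw [Real.log_sqrt hu0.le]; ring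
  have h3 := Real.log_le_sub_one_of_pos (Real.sqrt_pos.2 hu0)
  have h4 := Real.sq_sqrt hu0.le
  have h5 : (q k - x k) / 2 = q k * (1 - u) := by rw [hu]; field_simp; ring
  rw [h1, h2, h5, ← mul_add]
  refine mul_le_mul_of_nonneg_left ?_ hqk.le
  nlinarith

theorem midpointEntropy_nonneg (hq : q ∈ openSimplex K) (hx : x ∈ stdSimplex ℝ (Fin K)) :
    0 ≤ midpointEntropy q x :=
  (Finset.sum_nonneg fun k _ => mul_nonneg (hq.2 k).le (sq_nonneg _)).trans
    (sum_mul_sq_one_sub_sqrt_le_midpointEntropy hq hx)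

theorem midpointEntropy_le (hq : q ∈ openSimplex K) (hx : x ∈ stdSimplex ℝ (Fin K)) :
    midpointEntropy q x ≤ (∑ k, (q k - x k) ^ 2 / (x k + q k)) / 2 := by
  have hs : ∑ k, (q k - x k) / 2 = 0 := by
    rw [← Finset.sum_div, Finset.sum_sub_distrib, hq.1.2, hx.2]; simp
  rw [Finset.sum_div, ← add_zero (∑ k, _ / 2), ← hs, ← Finset.sum_add_distrib]
  refine Finset.sum_le_sum fun k _ => ?_
  have hqk := hq.2 k
  have hxk := hx.1 k
  have h : 0 < x k + q k := by linarith
  calc q k * Real.log (2 * q k / (x k + q k)) ≤ q k * (2 * q k / (x k + q k) - 1) :=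
        mul_le_mul_of_nonneg_left (Real.log_le_sub_one_of_pos (by positivity)) hqk.le
    _ = _ := by field_simp; ring

theorem midpointEntropy_le_log_two (hq : q ∈ openSimplex K) (hx : x ∈ stdSimplex ℝ (Fin K)) :
    midpointEntropy q x ≤ Real.log 2 := by
  rw [← one_mul (Real.log 2), ← hq.1.2, Finset.sum_mul]
  refine Finset.sum_le_sum fun k _ => mul_le_mul_of_nonneg_left ?_ (hq.2 k).le
  have hqk := hq.2 k
  have hxk := hx.1 k
  have h : 0 < x k + q k := by linarith
  exact Real.log_le_log (by positivity) ((div_le_iff₀ h).2 (by linarith))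

/-- A point of the simplex at which the entropy is small is close to `q`. -/
theorem tendsto_of_tendsto_midpointEntropy {x : ℕ → Fin K → ℝ} (hq : q ∈ openSimplex K)
    (hx : ∀ t, x t ∈ stdSimplex ℝ (Fin K))
    (h : Tendsto (fun t => midpointEntropy q (x t)) atTop (𝓝 0)) : Tendsto x atTop (𝓝 q) := by
  refine tendsto_pi_nhds.2 fun k => ?_
  have hqk := hq.2 k
  have h1 : Tendsto (fun t => (1 - √((x t k + q k) / (2 * q k))) ^ 2) atTop (𝓝 0) := by
    refine squeeze_zero (fun t => sq_nonneg _) (fun t => ?_)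
      (by simpa using h.div_const (q k))
    rw [le_div_iff₀ hqk, mul_comm]
    exact (Finset.single_le_sum (f := fun k => q k * (1 - √((x t k + q k) / (2 * q k))) ^ 2)
      (fun k _ => mul_nonneg (hq.2 k).le (sq_nonneg _)) (Finset.mem_univ k)).trans
      (sum_mul_sq_one_sub_sqrt_le_midpointEntropy hq (hx t))
  have h2 : Tendsto (fun t => 1 - √((x t k + q k) / (2 * q k))) atTop (𝓝 0) := by
    have := (Real.continuous_sqrt.tendsto 0).comp h1
    simp only [Function.comp_def, Real.sqrt_sq_eq_abs, Real.sqrt_zero] at this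
    exact (tendsto_zero_iff_abs_tendsto_zero _).2 this
  have h3 := (((tendsto_const_nhds (x := (1 : ℝ))).sub h2).pow 2).const_mul (2 * q k)
  have h4 := h3.sub_const (q k)
  convert h4 using 2 with t
  · have : 0 ≤ (x t k + q k) / (2 * q k) := by have := (hx t).1 k; positivity
    rw [sub_sub_cancel, Real.sq_sqrt this]
    field_simp
    ring
  · ring

/-- The second-order expansion of the entropy, with an error that is uniform on the simplex. -/
theorem midpointEntropy_le_add {y : Fin K → ℝ} (hq : q ∈ openSimplex K)
    (hx : x ∈ stdSimplex ℝ (Fin K)) (hy : y ∈ stdSimplex ℝ (Fin K)) :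
    midpointEntropy q y ≤ midpointEntropy q x - ∑ k, q k / (x k + q k) * (y k - x k)
      + ∑ k, (y k - x k) ^ 2 / q k := by
  unfold midpointEntropy
  rw [← Finset.sum_sub_distrib, ← Finset.sum_add_distrib]
  refine Finset.sum_le_sum fun k _ => ?_
  have hqk := hq.2 k
  have hxk := hx.1 k
  have hyk := hy.1 k
  have h : 0 < x k + q k := by linarith
  have h' : 0 < y k + q k := by linarith
  have h1 : Real.log (2 * q k / (y k + q k)) = Real.log (2 * q k / (x k + q k)) +
      Real.log ((x k + q k) / (y k + q k)) := by
    rw [← Real.log_mul (by positivity) (by positivity)]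
    congr 1
    field_simp
  have h2 := Real.log_le_sub_one_of_pos (div_pos h h')
  have h3 : q k * ((x k + q k) / (y k + q k) - 1) = - (q k / (x k + q k) * (y k - x k)) +
      q k * ((y k - x k) ^ 2 / ((x k + q k) * (y k + q k))) := by
    field_simp
    ring
  have h4 : q k * ((y k - x k) ^ 2 / ((x k + q k) * (y k + q k))) ≤ (y k - x k) ^ 2 / q k := by
    rw [← mul_div_assoc, div_le_div_iff₀ (by positivity) hqk]
    nlinarith [mul_nonneg (sq_nonneg (y k - x k)) (mul_nonneg hxk hyk),
      mul_nonneg (sq_nonneg (y k - x k)) (mul_nonneg hxk hqk.le),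
      mul_nonneg (sq_nonneg (y k - x k)) (mul_nonneg hyk hqk.le)]
  have h5 := mul_le_mul_of_nonneg_left h2 hqk.le
  rw [h1, mul_add]
  linarith

end

/-! ### Decrease of the Lyapunov function along the drift -/

theorem sum_weight_pos {K : ℕ} {θ β : ℝ} {ε x : Fin K → ℝ} (hθ : 0 < θ) (hε : ∀ k, 0 < ε k)
    (hx : x ∈ openSimplex K) : 0 < ∑ j, (θ * x j ^ (-β) + ε j) := by
  refine Finset.sum_pos (fun k _ => ?_) ?_
  · have := hε k
    have := Real.rpow_pos_of_pos (hx.2 k) (-β)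
    positivity
  · by_contra h
    have := hx.1.2
    simp [Finset.not_nonempty_iff_eq_empty.1 h] at this

theorem choiceProb_mem_stdSimplex {K : ℕ} {θ β : ℝ} {ε x : Fin K → ℝ} (hθ : 0 < θ)
    (hε : ∀ k, 0 < ε k) (hx : x ∈ openSimplex K) :
    choiceProb θ β ε x ∈ stdSimplex ℝ (Fin K) := by
  have hS := sum_weight_pos (β := β) hθ hε hx
  refine ⟨fun k => div_nonneg ?_ hS.le, ?_⟩
  · have := hε k
    have := Real.rpow_pos_of_pos (hx.2 k) (-β)
    positivity
  · simp only [choiceProb, ← Finset.sum_div]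
    exact div_self hS.ne'

/-- The entropy decreases along the drift, at a rate proportional to its size: if `q` is a fixed
point of `p`, then the derivative of the entropy in the direction `p(x) - x` is at most minus half
its value. The weights `θ x ^ (-β) + ε_k` are decreasing in `x`, so that
`(q_k - x_k) (p_k(x) - s q_k) ≥ 0`, where `s` is the ratio of the normalizing sums at `q` and at
`x`; what remains is an identity, because `q`, `x` and `p(x)` have the same sum. -/
theorem midpointEntropy_le_drift {K : ℕ} {θ β : ℝ} {ε q x : Fin K → ℝ} (hθ : 0 < θ) (hβ : 0 < β)
    (hε : ∀ k, 0 < ε k) (hq : q ∈ openSimplex K) (hfix : ∀ k, q k = choiceProb θ β ε q k)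
    (hx : x ∈ openSimplex K) :
    midpointEntropy q x / 2 ≤ ∑ k, q k / (x k + q k) * drift θ β ε x k := by
  have hp := choiceProb_mem_stdSimplex (β := β) hθ hε hx
  set p := choiceProb θ β ε x with hpdef
  have hS := sum_weight_pos (β := β) hθ hε hx
  have hS' := sum_weight_pos (β := β) hθ hε hq
  set S := ∑ j, (θ * x j ^ (-β) + ε j) with hSdef
  set S' := ∑ j, (θ * q j ^ (-β) + ε j) with hSdef'
  set s := S' / S with hs
  have hs0 : 0 < s := div_pos hS' hS
  have hsum1 : ∑ k, ((p k - x k) / 2 + (s - 1) / 4 * (q k - x k)) = 0 := by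
    rw [Finset.sum_add_distrib, ← Finset.sum_div, ← Finset.mul_sum, Finset.sum_sub_distrib,
      Finset.sum_sub_distrib, hp.2, hx.1.2, hq.1.2]
    simp
  have hmain : (∑ k, (q k - x k) ^ 2 / (x k + q k)) / 4 ≤
      ∑ k, q k / (x k + q k) * drift θ β ε x k := by
    rw [Finset.sum_div, ← add_zero (∑ k, _ / 4), ← hsum1, ← Finset.sum_add_distrib]
    refine Finset.sum_le_sum fun k _ => ?_
    have hqk := hq.2 k
    have hxk := hx.2 k
    have hd : 0 < x k + q k := by linarith
    have hmono : 0 ≤ (q k - x k) * (p k - s * q k) := by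
      have e1 : p k - s * q k = θ * (x k ^ (-β) - q k ^ (-β)) / S := by
        have h1 : S' * q k = θ * q k ^ (-β) + ε k := by
          conv_lhs => rw [hfix k]
          exact mul_div_cancel₀ _ hS'.ne'
        rw [hs, hpdef, div_mul_eq_mul_div, h1]
        simp only [choiceProb]
        rw [← hSdef]
        ring
      rw [e1, ← mul_div_assoc]
      refine div_nonneg ?_ hS.le
      rcases le_total (x k) (q k) with h | h
      · exact mul_nonneg (sub_nonneg.2 h) (mul_nonneg hθ.le (sub_nonneg.2
          (Real.rpow_le_rpow_of_nonpos hxk h (by linarith))))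
      · exact mul_nonneg_of_nonpos_of_nonpos (sub_nonpos.2 h)
          (mul_nonpos_of_nonneg_of_nonpos hθ.le (sub_nonpos.2
          (Real.rpow_le_rpow_of_nonpos hqk h (by linarith))))
    have e2 : q k / (x k + q k) * drift θ β ε x k =
        (q k - x k) ^ 2 / (x k + q k) / 4 + ((p k - x k) / 2 + (s - 1) / 4 * (q k - x k))
        + s * (q k - x k) ^ 2 / (x k + q k) / 4
        + (q k - x k) * (p k - s * q k) / (2 * (x k + q k)) := by
      simp only [drift, Pi.sub_apply, ← hpdef]
      field_simp
      ring
    have h1 : 0 ≤ s * (q k - x k) ^ 2 / (x k + q k) / 4 := by positivity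
    have h2 : 0 ≤ (q k - x k) * (p k - s * q k) / (2 * (x k + q k)) := by positivity
    linarith
  have := midpointEntropy_le hq hx.1
  linarith

/-! ### Convergence of almost supermartingales -/

/-- A deterministic step: if `z t` converges, its limit is nonnegative, and the sums of `a t * z t`
are bounded although those of `a t` are not, then the limit of `z` is zero. -/
theorem eq_zero_of_sum_mul_bddAbove {a z : ℕ → ℝ} {l B : ℝ} (ha : ∀ t, 0 ≤ a t)
    (ha_sum : Tendsto (fun n => ∑ t ∈ Finset.range n, a t) atTop atTop) (hz : ∀ t, 0 ≤ z t)
    (hl : Tendsto z atTop (𝓝 l)) (hB : ∀ n, ∑ t ∈ Finset.range n, a t * z t ≤ B) : l = 0 := by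
  by_contra hne
  have hl0 : 0 < l := lt_of_le_of_ne (ge_of_tendsto' hl hz) (Ne.symm hne)
  obtain ⟨T, hT⟩ := eventually_atTop.1 (hl.eventually_const_lt (half_lt_self hl0))
  have hbig := (ha_sum.const_mul_atTop (half_pos hl0)).eventually_gt_atTop
    (B + l / 2 * ∑ t ∈ Finset.range T, a t)
  obtain ⟨n, hn, hnT⟩ := (hbig.and (eventually_ge_atTop T)).exists
  have h1 : l / 2 * ∑ t ∈ Finset.Ico T n, a t ≤ ∑ t ∈ Finset.Ico T n, a t * z t := by
    rw [Finset.mul_sum]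
    refine Finset.sum_le_sum fun t ht => ?_
    rw [mul_comm]
    exact mul_le_mul_of_nonneg_left (hT t (Finset.mem_Ico.1 ht).1).le (ha t)
  have h2 := Finset.sum_range_add_sum_Ico a hnT
  have h3 := Finset.sum_range_add_sum_Ico (fun t => a t * z t) hnT
  have h4 : 0 ≤ ∑ t ∈ Finset.range T, a t * z t :=
    Finset.sum_nonneg fun t _ => mul_nonneg (ha t) (hz t)
  have := hB n
  rw [← h2] at hn
  nlinarith

/-- A form of the Robbins-Siegmund theorem: a nonnegative process that shrinks on average by the
factor `1 - a t`, up to a summable error `b t`, tends to zero if the sum of the `a t` diverges. -/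
theorem ae_tendsto_zero_of_condExp_succ_le {Ω : Type*} {mΩ : MeasurableSpace Ω} {P : Measure Ω}
    [IsProbabilityMeasure P] {ℱ : Filtration ℕ mΩ} {a b : ℕ → ℝ} {Z : ℕ → Ω → ℝ}
    (ha : ∀ t, 0 ≤ a t) (ha_sum : Tendsto (fun n => ∑ t ∈ Finset.range n, a t) atTop atTop)
    (hb : ∀ t, 0 ≤ b t) (hb_sum : Summable b) (hZ : StronglyAdapted ℱ Z)
    (hZ_int : ∀ t, Integrable (Z t) P) (hZ_nonneg : ∀ t, ∀ᵐ ω ∂P, 0 ≤ Z t ω)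
    (hstep : ∀ t, P[Z (t + 1) | ℱ t] ≤ᵐ[P] fun ω => (1 - a t) * Z t ω + b t) :
    ∀ᵐ ω ∂P, Tendsto (fun t => Z t ω) atTop (𝓝 0) := by
  -- `A t` compensates for the shrinking and the error, so that `Z + A` is a supermartingale.
  set A : ℕ → Ω → ℝ := fun n ω => ∑ t ∈ Finset.range n, (a t * Z t ω - b t) with hA
  have hA_meas : ∀ n, StronglyMeasurable[ℱ n] (A (n + 1)) := fun n => by
    refine Finset.stronglyMeasurable_fun_sum _ fun t ht => ?_
    have htn : t ≤ n := Nat.lt_succ_iff.1 (Finset.mem_range.1 ht)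
    exact (((hZ t).mono (ℱ.mono htn)).const_mul _).sub stronglyMeasurable_const
  have hA_meas' : ∀ n, StronglyMeasurable[ℱ n] (A n) := fun n => by
    refine Finset.stronglyMeasurable_fun_sum _ fun t ht => ?_
    exact (((hZ t).mono (ℱ.mono (Finset.mem_range.1 ht).le)).const_mul _).sub
      stronglyMeasurable_const
  have hA_int : ∀ n, Integrable (A n) P := fun n =>
    integrable_finsetSum _ fun t _ => ((hZ_int t).const_mul _).sub (integrable_const _)
  have hsuper : Supermartingale (fun n => Z n + A n) ℱ P := by
    refine supermartingale_nat (fun n => (hZ n).add (hA_meas' n))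
      (fun n => (hZ_int n).add (hA_int n)) fun n => ?_
    have h1 : P[Z (n + 1) + A (n + 1) | ℱ n] =ᵐ[P] P[Z (n + 1) | ℱ n] + A (n + 1) := by
      refine (condExp_add (hZ_int _) (hA_int _) _).trans ?_
      rw [condExp_of_stronglyMeasurable (ℱ.le n) (hA_meas n) (hA_int _)]
    filter_upwards [h1, hstep n] with ω h1 h2
    rw [h1]
    simp only [Pi.add_apply, hA, Finset.sum_range_succ]
    linarith
  have hnn : ∀ᵐ ω ∂P, ∀ t, 0 ≤ Z t ω := ae_all_iff.2 hZ_nonneg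
  have hsumb : ∀ n, ∑ t ∈ Finset.range n, b t ≤ ∑' t, b t := fun n =>
    hb_sum.sum_le_tsum _ fun t _ => hb t
  have hA_lower : ∀ᵐ ω ∂P, ∀ n, ∑ t ∈ Finset.range n, a t * Z t ω ≤ A n ω + ∑' t, b t := by
    filter_upwards with ω n
    have := hsumb n
    simp only [hA, Finset.sum_sub_distrib]
    linarith
  set C := ∑' t, b t with hC
  have hbdd : ∀ n, eLpNorm ((-fun n => Z n + A n) n) 1 P ≤
      ((∫ ω, (Z 0 + A 0) ω ∂P + 2 * C).toNNReal : ℝ≥0) := fun n => by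
    have hY_int : Integrable (Z n + A n) P := (hZ_int n).add (hA_int n)
    have hC0 : 0 ≤ C := tsum_nonneg hb
    rw [Pi.neg_apply, eLpNorm_neg, eLpNorm_one_eq_lintegral_enorm,
      ← ofReal_integral_norm_eq_lintegral_enorm hY_int]
    refine ENNReal.ofReal_le_ofReal ?_
    have h1 : ∫ ω, ‖(Z n + A n) ω‖ ∂P ≤ ∫ ω, ((Z n + A n) ω + 2 * C) ∂P := by
      refine integral_mono_ae hY_int.norm (hY_int.add (integrable_const _)) ?_
      filter_upwards [hnn, hA_lower] with ω h1 h2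
      have h3 : 0 ≤ ∑ t ∈ Finset.range n, a t * Z t ω :=
        Finset.sum_nonneg fun t _ => mul_nonneg (ha t) (h1 t)
      have := h2 n
      have := h1 n
      simp only [Pi.add_apply, Real.norm_eq_abs]
      exact abs_le.2 ⟨by linarith, by linarith⟩
    have h2 : ∫ ω, ((Z n + A n) ω + 2 * C) ∂P = ∫ ω, (Z n + A n) ω ∂P + 2 * C := by
      rw [integral_add hY_int (integrable_const _)]
      simp
    have h3 := hsuper.setIntegral_le (Nat.zero_le n) MeasurableSet.univ
    simp only [setIntegral_univ] at h3
    linarith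
  filter_upwards [hsuper.neg.exists_ae_tendsto_of_bdd hbdd, hnn, hA_lower] with ω ⟨c, hc⟩ h1 h2
  have hY : Tendsto (fun n => Z n ω + A n ω) atTop (𝓝 (-c)) := by
    simpa using hc.neg
  obtain ⟨B, hB⟩ := hY.bddAbove_range
  have hB' : ∀ n, ∑ t ∈ Finset.range n, a t * Z t ω ≤ B + C := fun n => by
    have := hB ⟨n, rfl⟩
    have := h2 n
    have := h1 n
    dsimp only at *
    linarith
  have hsum : Summable fun t => a t * Z t ω :=
    summable_of_sum_range_le (fun t => mul_nonneg (ha t) (h1 t)) hB'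
  have hAlim := (hsum.sub hb_sum).hasSum.tendsto_sum_nat
  have hZlim := hY.sub hAlim
  simp only [hA, add_sub_cancel_right] at hZlim
  have := eq_zero_of_sum_mul_bddAbove ha ha_sum h1 hZlim hB'
  rwa [this] at hZlim

/-! ### The step sizes -/

theorem stepSize_pos (N₀ t : ℕ) : 0 < stepSize N₀ t := by
  unfold stepSize; positivity

theorem stepSize_lt_one {N₀ : ℕ} (hN₀ : 0 < N₀) (t : ℕ) : stepSize N₀ t < 1 := by
  have h : (0 : ℝ) < population N₀ t := by
    have : 0 < population N₀ t := Nat.add_pos_left hN₀ t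
    exact_mod_cast this
  rw [stepSize, div_lt_one (by linarith)]
  linarith

theorem stepSize_eq (N₀ t : ℕ) : stepSize N₀ t = 1 / ((t + (N₀ + 1) : ℕ) : ℝ) := by
  simp only [stepSize, population]
  push_cast
  ring_nf

theorem tendsto_stepSize (N₀ : ℕ) : Tendsto (stepSize N₀) atTop (𝓝 0) := by
  simp_rw [funext (stepSize_eq N₀)]
  exact (tendsto_add_atTop_iff_nat (f := fun n : ℕ => 1 / (n : ℝ)) (N₀ + 1)).2
    tendsto_one_div_atTop_nhds_zero_nat

theorem tendsto_sum_stepSize (N₀ : ℕ) :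
    Tendsto (fun n => ∑ t ∈ Finset.range n, stepSize N₀ t) atTop atTop := by
  rw [← not_summable_iff_tendsto_nat_atTop_of_nonneg fun t => (stepSize_pos N₀ t).le]
  simp_rw [funext (stepSize_eq N₀)]
  exact mt (summable_nat_add_iff (f := fun n : ℕ => 1 / (n : ℝ)) (N₀ + 1)).1
    Real.not_summable_one_div_natCast

theorem summable_stepSize_sq (N₀ : ℕ) : Summable fun t => stepSize N₀ t ^ 2 := by
  simp_rw [stepSize_eq N₀, div_pow, one_pow]
  exact (summable_nat_add_iff (f := fun n : ℕ => 1 / (n : ℝ) ^ 2) (N₀ + 1)).2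
    (Real.summable_one_div_nat_pow.2 one_lt_two)

/-! ### Regularity of the drift -/

theorem measurable_choiceProb {K : ℕ} (θ β : ℝ) (ε : Fin K → ℝ) :
    Measurable (choiceProb θ β ε) := by
  unfold choiceProb
  fun_prop

theorem measurable_midpointEntropy {K : ℕ} (q : Fin K → ℝ) : Measurable (midpointEntropy q) := by
  unfold midpointEntropy
  fun_prop

theorem contDiffAt_drift {K : ℕ} {θ β : ℝ} {ε x : Fin K → ℝ} (hθ : 0 < θ)
    (hε : ∀ k, 0 < ε k) (hx : x ∈ openSimplex K) : ContDiffAt ℝ 1 (drift θ β ε) x := by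
  have hw : ∀ k, ContDiffAt ℝ 1 (fun y : Fin K → ℝ => θ * y k ^ (-β) + ε k) x := fun k =>
    (contDiffAt_const.mul ((contDiffAt_apply ℝ ℝ k x).rpow_const_of_ne (hx.2 k).ne')).add
      contDiffAt_const
  refine ContDiffAt.sub (contDiffAt_pi.2 fun k => ?_) contDiffAt_id
  exact (hw k).div (ContDiffAt.sum fun j _ => hw j) (sum_weight_pos hθ hε hx).ne'

theorem exists_lipschitzOnWith_drift {K : ℕ} {θ β : ℝ} {ε : Fin K → ℝ} (hθ : 0 < θ)
    (hε : ∀ k, 0 < ε k) {C : Set (Fin K → ℝ)} (hC : C ⊆ openSimplex K) (hC' : IsCompact C) :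
    ∃ L : ℝ≥0, LipschitzOnWith L (drift θ β ε) C := by
  refine LocallyLipschitzOn.exists_lipschitzOnWith_of_compact hC' fun x hx => ?_
  obtain ⟨L, t, ht, hL⟩ := (contDiffAt_drift (β := β) hθ hε (hC hx)).exists_lipschitzOnWith
  exact ⟨L, t, mem_nhdsWithin_of_mem_nhds ht, hL⟩

/-! ### The process -/

theorem abs_le_one_of_mem_stdSimplex {K : ℕ} {x : Fin K → ℝ} (hx : x ∈ stdSimplex ℝ (Fin K))
    (k : Fin K) : |x k| ≤ 1 :=
  abs_le.2 ⟨by linarith [hx.1 k], (mem_Icc_of_mem_stdSimplex hx k).2⟩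

theorem abs_sub_le_one_of_mem_stdSimplex {K : ℕ} {x y : Fin K → ℝ}
    (hx : x ∈ stdSimplex ℝ (Fin K)) (hy : y ∈ stdSimplex ℝ (Fin K)) (k : Fin K) :
    |x k - y k| ≤ 1 := by
  have hx' := mem_Icc_of_mem_stdSimplex hx k
  have hy' := mem_Icc_of_mem_stdSimplex hy k
  exact abs_le.2 ⟨by linarith [hx'.1, hy'.2], by linarith [hx'.2, hy'.1]⟩

/-- A step of size less than one from the open simplex towards a point of the simplex stays in the
open simplex. -/
theorem add_smul_sub_mem_openSimplex {K : ℕ} {x y z : Fin K → ℝ} {γ : ℝ} (hγ : 0 < γ)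
    (hγ' : γ < 1) (hx : x ∈ openSimplex K) (hy : y ∈ stdSimplex ℝ (Fin K))
    (hz : ∀ k, z k = x k + γ * (y k - x k)) : z ∈ openSimplex K := by
  have hpos : ∀ k, 0 < z k := fun k => by
    have h1 := mul_pos (sub_pos.2 hγ') (hx.2 k)
    have h2 := mul_nonneg hγ.le (hy.1 k)
    rw [hz k]
    linarith
  refine ⟨⟨fun k => (hpos k).le, ?_⟩, hpos⟩
  simp only [hz, Finset.sum_add_distrib, ← Finset.mul_sum, Finset.sum_sub_distrib, hx.1.2, hy.2]
  ring

section
variable {K : ℕ} {Ω : Type*} {mΩ : MeasurableSpace Ω} {P : Measure Ω}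
  {ℱ : Filtration ℕ mΩ} {θ β : ℝ} {ε q : Fin K → ℝ} {π X : ℕ → Ω → Fin K → ℝ}

theorem ae_mem_openSimplex {N₀ : ℕ} (hN₀ : 0 < N₀)
    (hπ_init : ∀ᵐ ω ∂P, π 0 ω ∈ openSimplex K)
    (hX_simplex : ∀ t, ∀ᵐ ω ∂P, X t ω ∈ stdSimplex ℝ (Fin K))
    (hupdate : ∀ t, ∀ᵐ ω ∂P, ∀ k,
      π (t + 1) ω k = π t ω k + stepSize N₀ t * (X t ω k - π t ω k)) (t : ℕ) :
    ∀ᵐ ω ∂P, π t ω ∈ openSimplex K := by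
  induction t with
  | zero => exact hπ_init
  | succ t ih =>
    filter_upwards [ih, hX_simplex t, hupdate t] with ω h1 h2 h3
    exact add_smul_sub_mem_openSimplex (stepSize_pos N₀ t) (stepSize_lt_one hN₀ t) h1 h2 h3

variable [IsProbabilityMeasure P]

theorem integrable_of_ae_mem_stdSimplex {Y : Ω → Fin K → ℝ} (hY : Measurable Y)
    (hY' : ∀ᵐ ω ∂P, Y ω ∈ stdSimplex ℝ (Fin K)) (k : Fin K) :
    Integrable (fun ω => Y ω k) P := by
  refine Integrable.of_bound (C := 1) ((measurable_pi_apply k).comp hY).aestronglyMeasurable ?_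
  filter_upwards [hY'] with ω h using abs_le_one_of_mem_stdSimplex h k

/-- The noise `X t - p(π(t))` is centred given the past. -/
theorem condExp_noise_eq_zero {t : ℕ} (hπ_adapted : Measurable[ℱ t] (π t))
    (hX_meas : Measurable[ℱ (t + 1)] (X t))
    (hX_simplex : ∀ᵐ ω ∂P, X t ω ∈ stdSimplex ℝ (Fin K))
    (hX_mean : ∀ k, P[fun ω => X t ω k | ℱ t] =ᵐ[P] fun ω => choiceProb θ β ε (π t ω) k)
    (k : Fin K) :
    P[fun ω => X t ω k - choiceProb θ β ε (π t ω) k | ℱ t] =ᵐ[P] 0 := by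
  have hp_meas : StronglyMeasurable[ℱ t] fun ω => choiceProb θ β ε (π t ω) k :=
    ((measurable_pi_apply k).comp
      ((measurable_choiceProb θ β ε).comp hπ_adapted)).stronglyMeasurable
  have hX_int := integrable_of_ae_mem_stdSimplex (hX_meas.mono (ℱ.le _) le_rfl) hX_simplex k
  have hp_int : Integrable (fun ω => choiceProb θ β ε (π t ω) k) P :=
    integrable_condExp.congr (hX_mean k)
  have h := condExp_sub hX_int hp_int (ℱ t)
  rw [condExp_of_stronglyMeasurable (ℱ.le t) hp_meas hp_int] at h
  filter_upwards [h, hX_mean k] with ω h1 h2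
  refine h1.trans ?_
  simp [h2]

/-- One step of the process shrinks the entropy on average, up to a second-order error. -/
theorem condExp_midpointEntropy_succ_le {γ : ℝ} {t : ℕ} (hθ : 0 < θ) (hβ : 0 < β)
    (hε : ∀ k, 0 < ε k) (hγ : 0 < γ)
    (hq : q ∈ openSimplex K) (hfix : ∀ k, q k = choiceProb θ β ε q k)
    (hπ_adapted : Measurable[ℱ t] (π t)) (hπ_adapted' : Measurable[ℱ (t + 1)] (π (t + 1)))
    (hX_meas : Measurable[ℱ (t + 1)] (X t))
    (hπ : ∀ᵐ ω ∂P, π t ω ∈ openSimplex K) (hπ' : ∀ᵐ ω ∂P, π (t + 1) ω ∈ openSimplex K)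
    (hX_simplex : ∀ᵐ ω ∂P, X t ω ∈ stdSimplex ℝ (Fin K))
    (hX_mean : ∀ k, P[fun ω => X t ω k | ℱ t] =ᵐ[P] fun ω => choiceProb θ β ε (π t ω) k)
    (hupdate : ∀ᵐ ω ∂P, ∀ k, π (t + 1) ω k = π t ω k + γ * (X t ω k - π t ω k)) :
    P[fun ω => midpointEntropy q (π (t + 1) ω) | ℱ t] ≤ᵐ[P]
      fun ω => (1 - γ / 2) * midpointEntropy q (π t ω) + (∑ k, 1 / q k) * γ ^ 2 := by
  have hent : ∀ {s} {m : MeasurableSpace Ω}, Measurable[m] (π s) →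
      StronglyMeasurable[m] fun ω => midpointEntropy q (π s ω) := fun h =>
    ((measurable_midpointEntropy q).comp h).stronglyMeasurable
  have hent_int : ∀ {s}, Measurable[mΩ] (π s) → (∀ᵐ ω ∂P, π s ω ∈ openSimplex K) →
      Integrable (fun ω => midpointEntropy q (π s ω)) P := fun hm h => by
    refine Integrable.of_bound (C := Real.log 2) (hent hm).aestronglyMeasurable ?_
    filter_upwards [h] with ω hω
    rw [Real.norm_of_nonneg (midpointEntropy_nonneg hq hω.1)]
    exact midpointEntropy_le_log_two hq hω.1
  -- The linear term of the expansion is split into the noise, with coefficients `c k` known at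
  -- time `t`, and the drift, which is known at time `t`.
  set c : Fin K → Ω → ℝ := fun k ω => q k / (π t ω k + q k) with hc
  set U : Fin K → Ω → ℝ := fun k ω => X t ω k - choiceProb θ β ε (π t ω) k with hU
  have hc_meas : ∀ k, StronglyMeasurable[ℱ t] (c k) := fun k =>
    (measurable_const.div (((measurable_pi_apply k).comp hπ_adapted).add
      measurable_const)).stronglyMeasurable
  have hc_bound : ∀ k, ∀ᵐ ω ∂P, ‖c k ω‖ ≤ 1 := fun k => by
    filter_upwards [hπ] with ω hω
    have h1 := hω.2 k
    have h2 := hq.2 k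
    rw [Real.norm_of_nonneg (by positivity)]
    exact (div_le_one (by positivity)).2 (by linarith)
  have hU_int : ∀ k, Integrable (U k) P := fun k =>
    (integrable_of_ae_mem_stdSimplex (hX_meas.mono (ℱ.le _) le_rfl) hX_simplex k).sub
      (integrable_condExp.congr (hX_mean k))
  have hcU_int : ∀ k, Integrable (c k * U k) P := fun k =>
    (hU_int k).bdd_mul ((hc_meas k).mono (ℱ.le t)).aestronglyMeasurable (hc_bound k)
  have hcU : P[∑ k, c k * U k | ℱ t] =ᵐ[P] 0 := by
    have h0 : ∀ᵐ ω ∂P, ∀ k, P[c k * U k | ℱ t] ω = 0 := ae_all_iff.2 fun k => by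
      filter_upwards [condExp_stronglyMeasurable_mul_of_bound (ℱ.le t) (hc_meas k) (hU_int k) 1
        (hc_bound k), condExp_noise_eq_zero hπ_adapted hX_meas hX_simplex hX_mean k] with ω h1 h2
      rw [h1, Pi.mul_apply, h2]
      simp
    filter_upwards [condExp_finsetSum (fun k _ => hcU_int k) (ℱ t), h0] with ω h1 h2
    rw [h1]
    simp [h2]
  set D : Ω → ℝ := fun ω =>
    (1 - γ / 2) * midpointEntropy q (π t ω) + (∑ k, 1 / q k) * γ ^ 2 with hD
  have hD_meas : StronglyMeasurable[ℱ t] D :=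
    ((hent hπ_adapted).const_mul _).add stronglyMeasurable_const
  have hD_int : Integrable D P :=
    ((hent_int (hπ_adapted.mono (ℱ.le _) le_rfl) hπ).const_mul _).add (integrable_const _)
  have hsum_int : Integrable (∑ k, c k * U k) P := integrable_finsetSum' _ fun k _ => hcU_int k
  have hle : (fun ω => midpointEntropy q (π (t + 1) ω)) ≤ᵐ[P] D - γ • ∑ k, c k * U k := by
    filter_upwards [hπ, hπ', hX_simplex, hupdate] with ω h1 h2 h3 h4
    have hexp := midpointEntropy_le_add hq h1.1 h2.1
    have hdrift := midpointEntropy_le_drift hθ hβ hε hq hfix h1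
    have e1 : ∑ k, q k / (π t ω k + q k) * (π (t + 1) ω k - π t ω k) =
        γ * ∑ k, q k / (π t ω k + q k) * drift θ β ε (π t ω) k + γ * ∑ k, c k ω * U k ω := by
      rw [← mul_add, ← Finset.sum_add_distrib, Finset.mul_sum]
      refine Finset.sum_congr rfl fun k _ => ?_
      simp only [h4 k, hc, hU, drift, Pi.sub_apply]
      ring
    have e2 : ∑ k, (π (t + 1) ω k - π t ω k) ^ 2 / q k ≤ (∑ k, 1 / q k) * γ ^ 2 := by
      rw [Finset.sum_mul]
      refine Finset.sum_le_sum fun k _ => ?_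
      rw [h4 k, add_sub_cancel_left, mul_pow, div_mul_eq_mul_div, one_mul]
      have h5 := (sq_le_one_iff_abs_le_one _).2 (abs_sub_le_one_of_mem_stdSimplex h3 h1.1 k)
      exact div_le_div_of_nonneg_right (mul_le_of_le_one_right (sq_nonneg γ) h5) (hq.2 k).le
    have e3 := mul_le_mul_of_nonneg_left hdrift hγ.le
    simp only [hD, Pi.sub_apply, Pi.smul_apply, Finset.sum_apply, Pi.mul_apply, smul_eq_mul]
    linarith
  have hmono := condExp_mono (m := ℱ t) (hent_int (hπ_adapted'.mono (ℱ.le _) le_rfl) hπ')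
    (hD_int.sub (hsum_int.smul γ)) hle
  have hsub := condExp_sub hD_int (hsum_int.smul γ) (ℱ t)
  rw [condExp_of_stronglyMeasurable (ℱ.le t) hD_meas hD_int] at hsub
  filter_upwards [hmono, hsub, condExp_smul γ (∑ k, c k * U k) (ℱ t), hcU] with ω h1 h2 h3 h4
  refine h1.trans_eq (h2.trans ?_)
  rw [Pi.sub_apply, h3, Pi.smul_apply, h4]
  simp

end

/-- `X t` is the quantity towards which the proportions move between `t` and `t + 1`: a point of
the simplex with conditional mean `p(π(t))` given the past. The choice `X t = p(π(t))` is the update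
`π(t+1) = π(t) + γ_t (p(π(t)) - π(t))`, and the choice of a random unit vector, equal to the `k`-th
one with conditional probability `p_k(π(t))`, is the same update with sampled entrants. -/
theorem mainTheorem2 {K : ℕ} {Ω : Type*} {mΩ : MeasurableSpace Ω}
    (P : Measure Ω) [IsProbabilityMeasure P] (ℱ : Filtration ℕ mΩ)
    (θ β : ℝ) (ε : Fin K → ℝ) (hθ : 0 < θ) (hβ : 0 < β) (hε : ∀ k, 0 < ε k)
    (N₀ : ℕ) (hN₀ : 0 < N₀)
    (π X : ℕ → Ω → Fin K → ℝ)
    (hπ_adapted : ∀ t, Measurable[ℱ t] (π t))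
    (hX_meas : ∀ t, Measurable[ℱ (t + 1)] (X t))
    (hπ_init : ∀ᵐ ω ∂P, π 0 ω ∈ openSimplex K)
    (hX_simplex : ∀ t, ∀ᵐ ω ∂P, X t ω ∈ stdSimplex ℝ (Fin K))
    (hX_mean : ∀ t k, P[fun ω => X t ω k | ℱ t] =ᵐ[P] fun ω => choiceProb θ β ε (π t ω) k)
    (hupdate : ∀ t, ∀ᵐ ω ∂P, ∀ k,
      π (t + 1) ω k = π t ω k + stepSize N₀ t * (X t ω k - π t ω k)) :
    IsRobbinsMonro P ℱ (stepSize N₀) (drift θ β ε) (openSimplex K) π ∧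
    ∃ πstar ∈ stdSimplex ℝ (Fin K),
      (∀ k, 0 < πstar k) ∧
      (∀ k, πstar k = choiceProb θ β ε πstar k) ∧
      ∀ᵐ ω ∂P, Tendsto (fun t => π t ω) atTop (𝓝 πstar) := by
  have hmem := ae_mem_openSimplex hN₀ hπ_init hX_simplex hupdate
  have hmem_all : ∀ᵐ ω ∂P, ∀ t, π t ω ∈ openSimplex K := ae_all_iff.2 hmem
  have hK : 0 < K := by
    obtain ⟨ω, hω⟩ := hπ_init.exists
    rcases Nat.eq_zero_or_pos K with rfl | h
    · have := hω.1.2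
      simp at this
    · exact h
  obtain ⟨q, hq, hfix⟩ := exists_choiceProb_eq_self hK hθ hβ hε
  have hlim : ∀ᵐ ω ∂P, Tendsto (fun t => π t ω) atTop (𝓝 q) := by
    have hent : ∀ᵐ ω ∂P, Tendsto (fun t => midpointEntropy q (π t ω)) atTop (𝓝 0) := by
      refine ae_tendsto_zero_of_condExp_succ_le (ℱ := ℱ) (a := fun t => stepSize N₀ t / 2)
        (b := fun t => (∑ k, 1 / q k) * stepSize N₀ t ^ 2)
        (fun t => (half_pos (stepSize_pos N₀ t)).le) ?_ (fun t => ?_)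
        ((summable_stepSize_sq N₀).mul_left _) (fun t => ?_) (fun t => ?_) (fun t => ?_)
        fun t => condExp_midpointEntropy_succ_le hθ hβ hε (stepSize_pos N₀ t) hq hfix
          (hπ_adapted t) (hπ_adapted (t + 1)) (hX_meas t) (hmem t) (hmem (t + 1)) (hX_simplex t)
          (hX_mean t) (hupdate t)
      · simp_rw [← Finset.sum_div]
        exact (tendsto_sum_stepSize N₀).atTop_div_const two_pos
      · exact mul_nonneg (Finset.sum_nonneg fun k _ => (one_div_pos.2 (hq.2 k)).le) (sq_nonneg _)
      · exact ((measurable_midpointEntropy q).comp (hπ_adapted t)).stronglyMeasurable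
      · refine Integrable.of_bound (C := Real.log 2) ((measurable_midpointEntropy q).comp
          ((hπ_adapted t).mono (ℱ.le t) le_rfl)).aestronglyMeasurable ?_
        filter_upwards [hmem t] with ω hω
        rw [Real.norm_of_nonneg (midpointEntropy_nonneg hq hω.1)]
        exact midpointEntropy_le_log_two hq hω.1
      · filter_upwards [hmem t] with ω hω using midpointEntropy_nonneg hq hω.1
    filter_upwards [hent, hmem_all] with ω h1 h2
    exact tendsto_of_tendsto_midpointEntropy hq (fun t => (h2 t).1) h1
  refine ⟨⟨stepSize_pos N₀, tendsto_stepSize N₀, tendsto_sum_stepSize N₀, summable_stepSize_sq N₀,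
    hπ_adapted, (bounded_stdSimplex (Fin K)).subset fun x hx => hx.1,
    fun C hC hC' => exists_lipschitzOnWith_drift hθ hε hC hC', ?_, ?_⟩,
    q, hq.1, hq.2, hfix, hlim⟩
  · -- A path in the open simplex that converges to a point of the open simplex is relatively
    -- compact there.
    filter_upwards [hlim, hmem_all] with ω h1 h2
    refine ⟨insert q (Set.range fun t => π t ω), ?_, h1.isCompact_insert_range,
      fun t => Set.mem_insert_of_mem _ ⟨t, rfl⟩⟩
    rintro x (rfl | ⟨t, rfl⟩)
    · exact hq
    · exact h2 t
  · refine ⟨fun t ω k => X t ω k - choiceProb θ β ε (π t ω) k, fun t => ?_, ⟨1, fun t => ?_⟩,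
      fun t k => condExp_noise_eq_zero (hπ_adapted t) (hX_meas t) (hX_simplex t) (hX_mean t) k, ?_⟩
    · exact (hX_meas t).sub ((measurable_choiceProb θ β ε).comp
        ((hπ_adapted t).mono (ℱ.mono (Nat.le_succ t)) le_rfl))
    · filter_upwards [hX_simplex t, hmem t] with ω h1 h2 k
      exact abs_sub_le_one_of_mem_stdSimplex h1 (choiceProb_mem_stdSimplex hθ hε h2) k
    · filter_upwards [ae_all_iff.2 hupdate] with ω h t
      ext k
      simp only [h t k, Pi.add_apply, Pi.smul_apply, drift, Pi.sub_apply, smul_eq_mul]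
      ring
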